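/- Let $n\ge 1$ be an odd integer, let $A_n$ be the Dynkin graph of type $A$ with $n$ vertices, that is, the path on the vertices $1,\dots,n$, and let $Q(A_n)=A(A_n)+D(A_n)$ be its signless Laplacian, the sum of the adjacency matrix $A(A_n)$ and the diagonal degree matrix $D(A_n)$. Let $$W_Q(A_n)=\left[\,e_n\;\; Q(A_n)e_n\;\;\cdots\;\; Q(A_n)^{n-1}e_n\,\right]$$ be the $Q$-walk matrix, where $e_n$ is the all-ones vector of dimension $n$. For an $n\times n$ integer matrix $M$ of rank $r$, let $D(0)=1$ and, for $1\le i\le n$, let $D(i)$ be the nonnegative greatest common divisor of all minors of order $i$ of $M$; the Smith normal form of $M$ is $\mathrm{diag}(d_1,\dots,d_r,0,\dots,0)$ with $d_i=D(i)/D(i-1)$ for $1\le i\le r$. Then $W_Q(A_n)$ has rank $r=\lceil n/2\rceil$, and its Smith normal form is $$\mathrm{diag}(\underbrace{1,2,2,\dots,2}_{r},0,\dots,0),$$ the $n\times n$ diagonal matrix whose first $r$ diagonal entries are one $1$ followed by $r-1$ entries equal to $2$, and whose remaining $n-r$ diagonal entries are $0$. -/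

import Mathlib

/-- The walk matrix `W(M) = [e, M e, …, M ^ (n - 1) e]` of an `n × n` integer matrix,
where `e` is the all-ones vector. -/
def walkMatrix {n : ℕ} (M : Matrix (Fin n) (Fin n) ℤ) : Matrix (Fin n) (Fin n) ℤ :=
  Matrix.of fun i j => (Matrix.mulVec (M ^ (j : ℕ)) (fun _ => 1)) i

/-- The signless Laplacian `Q(G) = A(G) + D(G)`. -/
def signlessLaplacian {n : ℕ} (G : SimpleGraph (Fin n)) [DecidableRel G.Adj] :
    Matrix (Fin n) (Fin n) ℤ :=
  G.adjMatrix ℤ + G.degMatrix ℤ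

/-- The `Q`-walk matrix `W_Q(G) = W(Q(G))`. -/
def qWalkMatrix {n : ℕ} (G : SimpleGraph (Fin n)) [DecidableRel G.Adj] :
    Matrix (Fin n) (Fin n) ℤ :=
  walkMatrix (signlessLaplacian G)

/-- The Dynkin graph `A_n`: the path on `n` vertices. -/
abbrev dynkinA (n : ℕ) : SimpleGraph (Fin n) := SimpleGraph.pathGraph n

instance dynkinADecidableAdj (n : ℕ) : DecidableRel (dynkinA n).Adj := fun _ _ =>
  decidable_of_iff' _ SimpleGraph.pathGraph_adj

/-- The rank of an integer matrix (over the field of rational numbers). -/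
noncomputable def intRank {n : ℕ} (M : Matrix (Fin n) (Fin n) ℤ) : ℕ :=
  (M.map (Int.cast : ℤ → ℚ)).rank

/-- The `k`-th determinant divisor `D(k)`: the (nonnegative) greatest common divisor of all
minors of order `k`, a minor being the determinant of the submatrix on `k` rows and `k` columns,
each listed increasingly. -/
def detDivisor {n : ℕ} (M : Matrix (Fin n) (Fin n) ℤ) (k : ℕ) : ℤ :=
  (Finset.univ.filter fun p : (Fin k → Fin n) × (Fin k → Fin n) =>
    StrictMono p.1 ∧ StrictMono p.2).gcd fun p => (M.submatrix p.1 p.2).det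

/-- `D(0) = 1`. -/
theorem detDivisor_zero {n : ℕ} (M : Matrix (Fin n) (Fin n) ℤ) : detDivisor M 0 = 1 := by
  have h : (Finset.univ.filter fun p : (Fin 0 → Fin n) × (Fin 0 → Fin n) =>
      StrictMono p.1 ∧ StrictMono p.2) = {default} := by
    ext p
    simp [Subsingleton.elim p default, StrictMono]
  simp [detDivisor, h]

/-- The `k`-th invariant factor `d_k = D(k) / D(k - 1)`, meaningful for `1 ≤ k ≤ rank M`. -/
def invariantFactor {n : ℕ} (M : Matrix (Fin n) (Fin n) ℤ) (k : ℕ) : ℤ :=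
  detDivisor M k / detDivisor M (k - 1)

/-- The Smith normal form `diag(d_1, …, d_r, 0, …, 0)` with `r = rank M`. The diagonal position
with zero-based index `i` holds `d_{i+1}`. -/
noncomputable def smithNormalForm {n : ℕ} (M : Matrix (Fin n) (Fin n) ℤ) :
    Matrix (Fin n) (Fin n) ℤ :=
  Matrix.diagonal fun i =>
    if (i : ℕ) < intRank M then invariantFactor M ((i : ℕ) + 1) else 0

/-! Write `Q`, `e` for the signless Laplacian and the all-ones vector, and `u` for `endpointVec`.
Since `Q e = 4 e - 2 u`, each column after the first is `4` times its predecessor minus `2 Q^k u`.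
Hence those columns are even and `2^s` divides every minor of order `s + 1`. Conversely, `Q^k u`
spreads inward from the ends one vertex per step, so the same column operations make the leading
minor of order `s + 1` essentially triangular, with value `±2^s` when `2 * s < n`. Thus `D(s + 1) =
2^s`, which also bounds the rank below. The reflection of the path pairs equal rows, which bounds it
above. -/

open Matrix in
theorem signlessLaplacian_dynkinA_mulVec {n : ℕ} (v : Fin n → ℤ) (i : Fin n) :
    (signlessLaplacian (dynkinA n) *ᵥ v) i =
      (if h : (i : ℕ) + 1 < n then v i + v ⟨i + 1, h⟩ else 0) +
        (if 0 < (i : ℕ) then v i + v ⟨i - 1, by omega⟩ else 0) := by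
  have key : (signlessLaplacian (dynkinA n) *ᵥ v) i =
      ∑ j, if (dynkinA n).Adj i j then v i + v j else 0 := by
    rw [signlessLaplacian, add_mulVec, Pi.add_apply, SimpleGraph.degMatrix_mulVec_apply,
      SimpleGraph.adjMatrix_mulVec_apply, (dynkinA n).degree_eq_sum_if_adj (R := ℤ),
      Finset.sum_mul, SimpleGraph.neighborFinset_eq_filter, Finset.sum_filter,
      ← Finset.sum_add_distrib]
    refine Finset.sum_congr rfl fun j _ => ?_
    split_ifs <;> ring
  have split : ∀ j : Fin n, (if (dynkinA n).Adj i j then v i + v j else 0) =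
      (if (i : ℕ) + 1 = j then v i + v j else 0) +
        (if (j : ℕ) + 1 = i then v i + v j else 0) := by
    intro j
    simp only [SimpleGraph.pathGraph_adj]
    split_ifs <;> omega
  rw [key, Finset.sum_congr rfl fun j _ => split j, Finset.sum_add_distrib]
  congr 1
  · split_ifs with h
    · rw [Finset.sum_eq_single_of_mem ⟨i + 1, h⟩ (Finset.mem_univ _)]
      · simp
      · intro j _ hj
        exact if_neg fun e => hj (Fin.ext e.symm)
    · exact Finset.sum_eq_zero fun j _ => if_neg (by omega)
  · split_ifs with h
    · rw [Finset.sum_eq_single_of_mem ⟨i - 1, by omega⟩ (Finset.mem_univ _)]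
      · exact if_pos (by simp only; omega)
      · intro j _ hj
        exact if_neg fun e => hj (Fin.ext (by simp only; omega))
    · exact Finset.sum_eq_zero fun j _ => if_neg (by omega)

/-- The sum of the standard basis vectors at the two ends of the path. -/
def endpointVec (n : ℕ) : Fin n → ℤ := fun i =>
  (if (i : ℕ) = 0 then 1 else 0) + if (i : ℕ) + 1 = n then 1 else 0

-- Every row sum of `Q` is twice a degree: `4` inside, `2` at an end. For `n = 1` the ends coincide,
-- `endpointVec` is `2`, and `Q e = 0` still fits.
open Matrix in
theorem signlessLaplacian_dynkinA_mulVec_one (n : ℕ) :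
    (signlessLaplacian (dynkinA n) *ᵥ fun _ => 1) =
      (4 : ℤ) • (fun _ => 1) + (-2 : ℤ) • endpointVec n := by
  ext i
  rw [signlessLaplacian_dynkinA_mulVec]
  simp only [endpointVec, Pi.add_apply, Pi.smul_apply, smul_eq_mul]
  split_ifs <;> omega

-- The front from the left end advances one vertex per step with coefficient `1`. The hypotheses put
-- `i` on or ahead of it, and out of reach of the front from the right end.
open Matrix in
theorem pow_signlessLaplacian_dynkinA_mulVec_endpointVec {n : ℕ} (k : ℕ) (i : Fin n)
    (hk : k ≤ i) (hi : (i : ℕ) + k + 1 < n) :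
    ((signlessLaplacian (dynkinA n)) ^ k *ᵥ endpointVec n) i = if (i : ℕ) = k then 1 else 0 := by
  induction k generalizing i with
  | zero =>
    have : (i : ℕ) + 1 ≠ n := by omega
    simp [endpointVec, this]
  | succ k ih =>
    rw [pow_succ', ← mulVec_mulVec, signlessLaplacian_dynkinA_mulVec, dif_pos (by omega),
      if_pos (by omega), ih i (by omega) (by omega), ih ⟨i + 1, _⟩ (by simp only; omega)
      (by simp only; omega), ih ⟨i - 1, _⟩ (by simp only; omega) (by simp only; omega)]
    simp only
    split_ifs <;> omega

theorem qWalkMatrix_apply_of_val_eq_zero {n : ℕ} (i j : Fin n) (hj : (j : ℕ) = 0) :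
    qWalkMatrix (dynkinA n) i j = 1 := by
  simp [qWalkMatrix, walkMatrix, hj]

open Matrix in
theorem qWalkMatrix_apply_of_val_eq_succ {n : ℕ} (i j j' : Fin n) (hj : (j : ℕ) = j' + 1) :
    qWalkMatrix (dynkinA n) i j =
      -2 * ((signlessLaplacian (dynkinA n)) ^ (j' : ℕ) *ᵥ endpointVec n) i +
        4 * qWalkMatrix (dynkinA n) i j' := by
  simp only [qWalkMatrix, walkMatrix, of_apply, hj]
  rw [pow_succ, ← mulVec_mulVec, signlessLaplacian_dynkinA_mulVec_one, mulVec_add, mulVec_smul,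
    mulVec_smul]
  simp only [Pi.add_apply, Pi.smul_apply, smul_eq_mul]
  ring

theorem two_dvd_qWalkMatrix_apply {n : ℕ} (i j : Fin n) (hj : 0 < (j : ℕ)) :
    2 ∣ qWalkMatrix (dynkinA n) i j := by
  rw [qWalkMatrix_apply_of_val_eq_succ i j ⟨j - 1, by omega⟩ (by simp only; omega)]
  exact dvd_add (Dvd.dvd.mul_right (by norm_num) _) (Dvd.dvd.mul_right (by norm_num) _)

-- Reflection of the path commutes with `Q` and fixes `e`.
open Matrix in
theorem qWalkMatrix_rev {n : ℕ} (i j : Fin n) :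
    qWalkMatrix (dynkinA n) i.rev j = qWalkMatrix (dynkinA n) i j := by
  obtain ⟨k, hk⟩ := j
  simp only [qWalkMatrix, walkMatrix, of_apply]
  clear hk
  induction k generalizing i with
  | zero => simp
  | succ k ih =>
    have hv : ∀ a b : Fin n, (a : ℕ) + b + 1 = n →
        (signlessLaplacian (dynkinA n) ^ k *ᵥ fun _ => 1) a =
          (signlessLaplacian (dynkinA n) ^ k *ᵥ fun _ => 1) b := by
      intro a b hab
      rw [← ih b]
      congr 1
      ext
      rw [Fin.val_rev]
      omega
    rw [pow_succ', ← mulVec_mulVec, signlessLaplacian_dynkinA_mulVec,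
      signlessLaplacian_dynkinA_mulVec, add_comm]
    congr 1
    · by_cases h : (i : ℕ) + 1 < n
      · rw [if_pos (by rw [Fin.val_rev]; omega), dif_pos h, ih,
          hv ⟨i.rev - 1, _⟩ ⟨i + 1, h⟩ (by simp only [Fin.val_rev]; omega)]
      · rw [if_neg (by rw [Fin.val_rev]; omega), dif_neg h]
    · by_cases h : 0 < (i : ℕ)
      · rw [dif_pos (by rw [Fin.val_rev]; omega), if_pos h, ih,
          hv ⟨i.rev + 1, _⟩ ⟨i - 1, _⟩ (by simp only [Fin.val_rev]; omega)]
      · rw [dif_neg (by rw [Fin.val_rev]; omega), if_neg h]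

/-- A minor of order `s + 1` whose columns, except possibly the first, are divisible by `c` is
divisible by `c ^ s`. -/
theorem pow_dvd_det_of_dvd_succ_col {R : Type*} [CommRing R] {s : ℕ}
    (M : Matrix (Fin (s + 1)) (Fin (s + 1)) R) (c : R) (h : ∀ i (j : Fin s), c ∣ M i j.succ) :
    c ^ s ∣ M.det := by
  choose q hq using h
  -- Factor the column scalars `1, c, …, c` out of `M`.
  have hM : M = Matrix.of fun i j => (Fin.cons 1 (fun _ => c) : Fin (s + 1) → R) j *
      (Fin.cons (M i 0) (q i) : Fin (s + 1) → R) j := by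
    ext i j
    refine Fin.cases ?_ (fun j => ?_) j
    · simp
    · simp [hq]
  rw [hM, Matrix.det_mul_row _ (fun i j => (Fin.cons (M i 0) (q i) : Fin (s + 1) → R) j),
    Fin.prod_univ_succ]
  simp

theorem pow_dvd_detDivisor_qWalkMatrix {n : ℕ} (s : ℕ) :
    2 ^ s ∣ detDivisor (qWalkMatrix (dynkinA n)) (s + 1) := by
  refine Finset.dvd_gcd fun p hp => pow_dvd_det_of_dvd_succ_col _ _ fun i j => ?_
  refine two_dvd_qWalkMatrix_apply _ _ ?_
  -- Columns are listed increasingly, so only the first can be column `0`, the one that is not even.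
  have := (Finset.mem_filter.1 hp).2.2 (Fin.succ_pos j)
  exact lt_of_le_of_lt (Nat.zero_le _) this

open Matrix in
/-- The leading principal minors of order at most `⌈n / 2⌉` of the `Q`-walk matrix. -/
theorem natAbs_det_submatrix_castLE_qWalkMatrix {n s : ℕ} (hs : 2 * s < n) (h : s + 1 ≤ n) :
    ((qWalkMatrix (dynkinA n)).submatrix (Fin.castLE h) (Fin.castLE h)).det.natAbs = 2 ^ s := by
  set B : Matrix (Fin (s + 1)) (Fin (s + 1)) ℤ := of fun i =>
    Fin.cons 1 fun j : Fin s => -2 *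
      ((signlessLaplacian (dynkinA n)) ^ (j : ℕ) *ᵥ endpointVec n) (Fin.castLE h i) with hB
  have hdet : ((qWalkMatrix (dynkinA n)).submatrix (Fin.castLE h) (Fin.castLE h)).det = B.det := by
    refine det_eq_of_forall_col_eq_smul_add_pred (fun _ => 4) (fun i => ?_) (fun i j => ?_)
    · exact qWalkMatrix_apply_of_val_eq_zero _ _ rfl
    · exact qWalkMatrix_apply_of_val_eq_succ _ _ (Fin.castLE h j.castSucc) rfl
  have hsucc : ∀ (i : Fin (s + 1)) (j : Fin s), (j : ℕ) ≤ i →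
      B i j.succ = if (i : ℕ) = j then -2 else 0 := by
    intro i j hij
    simp only [hB, of_apply, Fin.cons_succ]
    rw [pow_signlessLaplacian_dynkinA_mulVec_endpointVec _ (Fin.castLE h i) hij
      (by rw [Fin.val_castLE]; omega)]
    simp
  have htri : (B.submatrix (Fin.last s).succAbove (Fin.succAbove 0)).det = (-2) ^ s := by
    rw [det_of_isUpperTriangular]
    · simp [hsucc]
    · intro i j hij
      have hij' : (j : ℕ) < i := hij
      simp only [submatrix_apply, Fin.succAbove_last, Fin.succAbove_zero]
      rw [hsucc _ _ (by simpa using hij'.le), if_neg (by simpa using hij'.ne')]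
  -- The last row of `B` is `(1, 0, …, 0)`: row `s` lies ahead of both fronts for all exponents
  -- below `s`, because `2 * s < n`.
  rw [hdet, det_succ_row B (Fin.last s), Fin.sum_univ_succ, Finset.sum_eq_zero fun j _ => ?_, htri]
  · simp [hB, Int.natAbs_mul, Int.natAbs_pow]
  · rw [hsucc _ _ (by simp only [Fin.val_last]; omega), if_neg (by simp only [Fin.val_last]; omega)]
    ring

theorem detDivisor_nonneg {n : ℕ} (M : Matrix (Fin n) (Fin n) ℤ) (k : ℕ) :
    0 ≤ detDivisor M k :=
  Int.nonneg_of_normalize_eq_self Finset.normalize_gcd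

theorem detDivisor_succ_qWalkMatrix {n s : ℕ} (hs : 2 * s < n) :
    detDivisor (qWalkMatrix (dynkinA n)) (s + 1) = 2 ^ s := by
  have h : s + 1 ≤ n := by omega
  refine Int.dvd_antisymm (detDivisor_nonneg _ _) (by positivity) ?_
    (pow_dvd_detDivisor_qWalkMatrix s)
  have hmem : (Fin.castLE h, Fin.castLE h) ∈
      Finset.univ.filter fun p : (Fin (s + 1) → Fin n) × (Fin (s + 1) → Fin n) =>
        StrictMono p.1 ∧ StrictMono p.2 := by
    simp [Fin.strictMono_castLE]
  have hdvd := Finset.gcd_dvd hmem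
    (f := fun p => ((qWalkMatrix (dynkinA n)).submatrix p.1 p.2).det)
  rw [← Int.dvd_natAbs, natAbs_det_submatrix_castLE_qWalkMatrix hs h] at hdvd
  exact_mod_cast hdvd

open Matrix in
theorem intRank_qWalkMatrix_dynkinA (t : ℕ) :
    intRank (qWalkMatrix (dynkinA (2 * t + 1))) = t + 1 := by
  set W := (qWalkMatrix (dynkinA (2 * t + 1))).map (Int.cast : ℤ → ℚ) with hW
  have h : t + 1 ≤ 2 * t + 1 := by omega
  refine le_antisymm ?_ ?_
  -- Folding the path at its middle vertex, row `i` equals row `min i i.rev`, so `W` factors through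
  -- its first `t + 1` rows.
  · have hfac : W = (of fun (i : Fin (2 * t + 1)) (a : Fin (t + 1)) =>
        if min (i : ℕ) (i.rev : ℕ) = a then (1 : ℚ) else 0) *
          W.submatrix (Fin.castLE h) id := by
      ext i j
      have hlt : min (i : ℕ) (i.rev : ℕ) < t + 1 := by
        rw [Fin.val_rev]
        omega
      rw [mul_apply, Finset.sum_eq_single_of_mem ⟨_, hlt⟩ (Finset.mem_univ _)]
      · simp only [of_apply, if_true, one_mul, submatrix_apply, id, hW, map_apply]
        congr 1
        rcases le_total (i : ℕ) (i.rev : ℕ) with hle | hle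
        · congr 1
          ext
          simp only [Fin.val_castLE, min_eq_left hle]
        · rw [← qWalkMatrix_rev]
          congr 1
          ext
          simp only [Fin.val_castLE, min_eq_right hle]
      · intro a _ ha
        rw [of_apply, if_neg fun e => ha (Fin.ext e.symm), zero_mul]
    rw [intRank, ← hW, hfac]
    exact (rank_mul_le_left _ _).trans ((rank_le_card_width _).trans (by simp))
  · have hdet := natAbs_det_submatrix_castLE_qWalkMatrix (n := 2 * t + 1) (s := t) (by omega) h
    have hunit : IsUnit (W.submatrix (Fin.castLE h) (Fin.castLE h)) := by
      rw [isUnit_iff_isUnit_det, isUnit_iff_ne_zero]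
      have hcast : (W.submatrix (Fin.castLE h) (Fin.castLE h)).det =
          (((qWalkMatrix (dynkinA (2 * t + 1))).submatrix
            (Fin.castLE h) (Fin.castLE h)).det : ℚ) := by
        rw [Int.cast_det]
        rfl
      rw [hcast, Int.cast_ne_zero, ← Int.natAbs_ne_zero, hdet]
      positivity
    calc t + 1 = (W.submatrix (Fin.castLE h) (Fin.castLE h)).rank := by
          rw [rank_of_isUnit _ hunit, Fintype.card_fin]
      _ ≤ W.rank := rank_submatrix_le _ _ _

theorem mainTheorem2 (n : ℕ) (hn : Odd n) :
    intRank (qWalkMatrix (dynkinA n)) = ⌈(n : ℚ) / 2⌉₊ ∧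
    smithNormalForm (qWalkMatrix (dynkinA n)) =
      Matrix.diagonal fun i : Fin n =>
        if (i : ℕ) = 0 then 1 else if (i : ℕ) < ⌈(n : ℚ) / 2⌉₊ then 2 else 0 := by
  obtain ⟨t, rfl⟩ := hn
  have hceil : ⌈((2 * t + 1 : ℕ) : ℚ) / 2⌉₊ = t + 1 := by
    rw [Nat.ceil_eq_iff (by omega)]
    constructor <;> push_cast [Nat.add_sub_cancel] <;> linarith
  rw [hceil, smithNormalForm, intRank_qWalkMatrix_dynkinA]
  refine ⟨rfl, congrArg _ (funext fun i => ?_)⟩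
  obtain ⟨_ | i, hi⟩ := i
  · simp [invariantFactor, detDivisor_succ_qWalkMatrix (s := 0), detDivisor_zero]
  · simp only [Nat.add_eq_zero_iff, one_ne_zero, and_false, if_false]
    split_ifs with hlt
    · rw [invariantFactor, Nat.add_sub_cancel, detDivisor_succ_qWalkMatrix (by omega),
        detDivisor_succ_qWalkMatrix (by omega), pow_succ,
        Int.mul_ediv_cancel_left _ (by positivity)]
    · rfl
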